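/- Let $n\ge 4$, let $0<d<1/\sqrt{45}$ and $b_1,b_2\in\mathbb R$, and let $$B=\begin{pmatrix}\frac23&\frac1{\sqrt3}&d\\-\frac1{\sqrt3}&0&\sqrt3\,d\\d&-\sqrt3\,d&b_1+ib_2\end{pmatrix}.$$ For $\varepsilon>0$ let $T$ be the $n\times n$ matrix $$T=\begin{pmatrix}B&0\\0&0_{n-3}\end{pmatrix}+\Bigl(\varepsilon+\tfrac32d^2-b_1-ib_2\Bigr)E_{33}+\sum_{k=1}^{n-3}\varepsilon^k\bigl(E_{k+2,k+3}+E_{k+3,k+3}\bigr),$$ where $E_{kl}$ are the $n\times n$ matrix units. Let $\|T\|$ be the operator norm, $W(T)=\{\langle Tx,x\rangle:x\in\mathbb C^n,\ \|x\|=1\}$ the numerical range and $w(T)=\sup\{|\mu|:\mu\in W(T)\}$ the numerical radius. Then there is $\varepsilon_0>0$ such that for all $0<\varepsilon<\varepsilon_0$: * $W(T)\subseteq S(\pi/2)=\{z\in\mathbb C:\operatorname{Re}z\ge0\}$, i.e. $T+T^*$ is positive semidefinite; * $\|T\|/w(T)=\sqrt2$; * $T$ is unitarily irreducible, i.e. not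 unitarily similar to a direct sum of two square matrices of positive sizes. In particular, $T/\|T\|$ is not unitarily similar to $T_1\oplus T_2$ for any square matrix $T_2$, where $$T_1=\frac13\begin{pmatrix}1+i\sqrt2&2\\0&1-i\sqrt2\end{pmatrix}.$$ -/

import Mathlib

open scoped Matrix ComplexOrder

noncomputable section

/-- The operator on the Hilbert space `ℂ^ι` (with its Euclidean norm) given by a square matrix. -/
abbrev matrixOp {ι : Type*} [Fintype ι] [DecidableEq ι] (M : Matrix ι ι ℂ) :
    EuclideanSpace ℂ ι →L[ℂ] EuclideanSpace ℂ ι :=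
  Matrix.toEuclideanCLM (n := ι) (𝕜 := ℂ) M

/-- The operator norm `‖M‖` of a square matrix, induced by the Euclidean norm. -/
def matrixNorm {ι : Type*} [Fintype ι] [DecidableEq ι] (M : Matrix ι ι ℂ) : ℝ :=
  ‖matrixOp M‖

/-- The numerical range `W(T) = {⟨Tx, x⟩ : ‖x‖ = 1}`.  The inner product `inner ℂ u v` of Mathlib
is conjugate-linear in `u` and linear in `v`, so `⟨Tx, x⟩` (linear in the first entry) is
`inner ℂ x (T x)`. -/
def numericalRange {ι : Type*} [Fintype ι] [DecidableEq ι] (M : Matrix ι ι ℂ) : Set ℂ :=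
  {z | ∃ x : EuclideanSpace ℂ ι, ‖x‖ = 1 ∧ inner ℂ x (matrixOp M x) = z}

/-- The numerical radius `w(T) = sup {|μ| : μ ∈ W(T)}`. -/
def numericalRadius {ι : Type*} [Fintype ι] [DecidableEq ι] (M : Matrix ι ι ℂ) : ℝ :=
  sSup ((fun z : ℂ => ‖z‖) '' numericalRange M)

/-- The sector `S(α) = {a + ib : |b| ≤ a tan α}` for `α ∈ [0, π/2]`, with the tangent cleared, so
that `S(π/2)` is the closed right half plane. -/
def sector (α : ℝ) : Set ℂ :=
  {z | 0 ≤ z.re ∧ |z.im| * Real.cos α ≤ z.re * Real.sin α}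

/-- Two square matrices are unitarily similar: `U* S U = R` for some unitary `U`.  The index types
may differ; a two-sided unitary `U` exists only if they have the same cardinality. -/
def UnitarilySimilar {ι κ : Type*} [Fintype ι] [DecidableEq ι] [Fintype κ] [DecidableEq κ]
    (S : Matrix ι ι ℂ) (R : Matrix κ κ ℂ) : Prop :=
  ∃ U : Matrix ι κ ℂ, Uᴴ * U = 1 ∧ U * Uᴴ = 1 ∧ Uᴴ * S * U = R

/-- The direct sum `A ⊕ C` of two square matrices. -/
abbrev matrixDirectSum {ι κ : Type*} (A : Matrix ι ι ℂ) (C : Matrix κ κ ℂ) :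
    Matrix (ι ⊕ κ) (ι ⊕ κ) ℂ :=
  Matrix.fromBlocks A 0 0 C

/-- A square matrix is unitarily irreducible if it is not unitarily similar to a direct sum of two
square matrices of positive sizes. -/
def UnitarilyIrreducible {ι : Type*} [Fintype ι] [DecidableEq ι] (S : Matrix ι ι ℂ) : Prop :=
  ¬ ∃ (p q : ℕ) (A : Matrix (Fin p) (Fin p) ℂ) (C : Matrix (Fin q) (Fin q) ℂ),
    0 < p ∧ 0 < q ∧ UnitarilySimilar S (matrixDirectSum A C)

/-- The `3 × 3` matrix `B` with parameters `d, b₁, b₂`. -/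
def matB (d b₁ b₂ : ℝ) : Matrix (Fin 3) (Fin 3) ℂ :=
  !![2 / 3, 1 / (√3 : ℝ), (d : ℂ);
     -(1 / (√3 : ℝ)), 0, (√3 : ℝ) * (d : ℂ);
     (d : ℂ), -((√3 : ℝ) * (d : ℂ)), (b₁ : ℂ) + Complex.I * (b₂ : ℂ)]

/-- The `n × n` matrix `A ⊕ 0` with the `3 × 3` matrix `A` in its upper left corner (`n ≥ 3`). -/
def padZero (n : ℕ) (A : Matrix (Fin 3) (Fin 3) ℂ) : Matrix (Fin n) (Fin n) ℂ :=
  Matrix.of fun i j =>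
    if h : (i : ℕ) < 3 ∧ (j : ℕ) < 3 then A ⟨i, h.1⟩ ⟨j, h.2⟩ else 0

/-- The matrix unit `E_{kl}` of size `n`, where rows and columns are numbered from `1` to `n`. -/
def matE (n k l : ℕ) : Matrix (Fin n) (Fin n) ℂ :=
  Matrix.of fun i j => if (i : ℕ) + 1 = k ∧ (j : ℕ) + 1 = l then 1 else 0

/-- The matrix
`T = (B ⊕ 0) + (ε + 3d²/2 - b₁ - i b₂) E₃₃ + ∑_{k=1}^{n-3} ε^k (E_{k+2,k+3} + E_{k+3,k+3})`. -/
def matT (n : ℕ) (d b₁ b₂ ε : ℝ) : Matrix (Fin n) (Fin n) ℂ :=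
  padZero n (matB d b₁ b₂)
    + ((ε : ℂ) + 3 * (d : ℂ) ^ 2 / 2 - (b₁ : ℂ) - Complex.I * (b₂ : ℂ)) • matE n 3 3
    + ∑ k ∈ Finset.Icc 1 (n - 3),
        ((ε : ℂ) ^ k) • (matE n (k + 2) (k + 3) + matE n (k + 3) (k + 3))

/-- The `2 × 2` extremal matrix for the ratio `‖T‖ / w(T)` over the sector `S(α)`, where
`s = sin² α`. -/
def extremalMatrix (α : ℝ) : Matrix (Fin 2) (Fin 2) ℂ :=
  let s : ℝ := Real.sin α ^ 2
  (((1 / (1 + 2 * s) : ℝ)) : ℂ) •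
    !![((√(1 + s - s ^ 2) : ℝ) : ℂ) + Complex.I * ((√(s + s ^ 2) : ℝ) : ℂ), ((2 * s : ℝ) : ℂ);
       0, ((√(1 + s - s ^ 2) : ℝ) : ℂ) - Complex.I * ((√(s + s ^ 2) : ℝ) : ℂ)]

end

open scoped Matrix ComplexOrder

/-! The multiple of E₃₃ cancels b₁ + i b₂, so T is a leading 3×3 block depending only on d, plus an
upper bidiagonal tail of size O(ε) on the coordinates from the third on.

Norm: with f = (√3, 1, 0, …) and g = (√3, -1, 0, …) one has T f = g and Tᴴ g = f. The direction
orthogonal to f in the first two coordinates, and the tail, each contribute a definite loss of norm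
(`sum_normSq_matT_mulVec_le`). Hence ‖T‖ = 1, attained only along f.

Numerical range: the upper left 2×2 block has an elliptical numerical range touching the circle |μ|
= 1/√2 at (1 ± i)/2. The couplings to the third coordinate z are tangential there to first order,
and cost at most 45 d² |z|² (`norm_leadingForm_le`); the slack 1 - 45 d² absorbs the tail for small
ε, so w(T) = 1/√2. The real part of the form is a square plus a tail form that is nonnegative by
telescoping.

Irreducibility: a matrix X commuting with T and Tᴴ preserves the fixed space ℂf of TᴴT, so f is an
eigenvector of X. Its eigenspace is invariant under T and Tᴴ, and f generates the whole space under
them; thus X is scalar, whereas a direct sum would supply a nonscalar commuting projection. -/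

/-- A vector of length `n`, extended by zero to a sequence indexed by `ℕ`. -/
def extendZero {n : ℕ} (x : Fin n → ℂ) (j : ℕ) : ℂ :=
  if h : j < n then x ⟨j, h⟩ else 0

theorem extendZero_of_lt {n : ℕ} (x : Fin n → ℂ) {j : ℕ} (h : j < n) :
    extendZero x j = x ⟨j, h⟩ := dif_pos h

theorem extendZero_of_le {n : ℕ} (x : Fin n → ℂ) {j : ℕ} (h : n ≤ j) :
    extendZero x j = 0 := dif_neg (by omega)

/-! ### Coordinates of `T x` -/

theorem matE_mulVec (n k l : ℕ) (hl : 0 < l) (x : Fin n → ℂ) (i : Fin n) :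
    (matE n k l *ᵥ x) i = if (i : ℕ) + 1 = k then extendZero x (l - 1) else 0 := by
  simp only [Matrix.mulVec, dotProduct, matE, Matrix.of_apply]
  by_cases hk : (i : ℕ) + 1 = k
  · simp only [hk, true_and, if_true]
    by_cases h : l - 1 < n
    · rw [extendZero_of_lt x h, Finset.sum_eq_single ⟨l - 1, h⟩]
      · simp; omega
      · intro j _ hj
        have : (j : ℕ) + 1 ≠ l := fun h' => hj (Fin.ext (by simp; omega))
        simp [this]
      · simp
    · rw [extendZero_of_le x (by omega)]
      refine Finset.sum_eq_zero fun j _ => ?_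
      have : (j : ℕ) + 1 ≠ l := by omega
      simp [this]
  · simp [hk]

theorem sum_fin_add_three {M : Type*} [AddCommMonoid M] (m : ℕ) (F : Fin (m + 3) → M) :
    ∑ i, F i = F 0 + (F 1 + ∑ j ∈ Finset.range (m + 1),
      if h : j + 2 < m + 3 then F ⟨j + 2, h⟩ else 0) := by
  rw [Fin.sum_univ_succ, Fin.sum_univ_succ, Finset.sum_range]
  congr 2
  refine Finset.sum_congr rfl fun j _ => ?_
  rw [dif_pos (by omega)]
  rfl

theorem fin_two_eq_mk (m : ℕ) : (2 : Fin (m + 3)) = ⟨2, by omega⟩ :=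
  Fin.ext (Nat.mod_eq_of_lt (show 2 < m + 3 by omega))

theorem padZero_mulVec (m : ℕ) (A : Matrix (Fin 3) (Fin 3) ℂ) (x : Fin (m + 3) → ℂ)
    (i : Fin (m + 3)) :
    (padZero (m + 3) A *ᵥ x) i = if h : (i : ℕ) < 3 then
      A ⟨i, h⟩ 0 * x 0 + A ⟨i, h⟩ 1 * x 1 + A ⟨i, h⟩ 2 * x 2 else 0 := by
  simp only [Matrix.mulVec, dotProduct, padZero, Matrix.of_apply]
  by_cases h : (i : ℕ) < 3
  · rw [Fin.sum_univ_succ, Fin.sum_univ_succ, Fin.sum_univ_succ, Finset.sum_eq_zero]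
    · simp [fin_two_eq_mk, h, ← add_assoc]
    · intro j _
      rw [dif_neg, zero_mul]
      simp
  · simp [h]

theorem matT_mulVec (m : ℕ) (d b₁ b₂ ε : ℝ) (x : Fin (m + 3) → ℂ) (i : Fin (m + 3)) :
    (matT (m + 3) d b₁ b₂ ε *ᵥ x) i = (padZero (m + 3) (matB d b₁ b₂) *ᵥ x) i
      + (if (i : ℕ) + 1 = 3 then
        ((ε : ℂ) + 3 * (d : ℂ) ^ 2 / 2 - (b₁ : ℂ) - Complex.I * (b₂ : ℂ)) * x 2 else 0)
      + ∑ k ∈ Finset.Icc 1 m, (ε : ℂ) ^ k *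
        ((if (i : ℕ) + 1 = k + 2 then extendZero x (k + 2) else 0)
          + if (i : ℕ) + 1 = k + 3 then extendZero x (k + 2) else 0) := by
  simp only [matT, Matrix.add_mulVec, Matrix.sum_mulVec, Matrix.smul_mulVec, Pi.add_apply,
    Finset.sum_apply, Pi.smul_apply, smul_eq_mul, Nat.add_sub_cancel]
  congr 1
  · rw [matE_mulVec _ _ _ (by norm_num)]
    congr 1
    rw [mul_ite, mul_zero]
    rfl
  · refine Finset.sum_congr rfl fun k _ => ?_
    rw [matE_mulVec _ _ _ (by omega), matE_mulVec _ _ _ (by omega)]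
    rfl

theorem matT_mulVec_zero (m : ℕ) (d b₁ b₂ ε : ℝ) (x : Fin (m + 3) → ℂ) :
    (matT (m + 3) d b₁ b₂ ε *ᵥ x) 0
      = 2 / 3 * x 0 + 1 / (√3 : ℝ) * x 1 + d * x 2 := by
  rw [matT_mulVec, padZero_mulVec, Finset.sum_eq_zero]
  · simp [matB]
  · intro k hk
    have := Finset.mem_Icc.1 hk
    simp

theorem matT_mulVec_one (m : ℕ) (d b₁ b₂ ε : ℝ) (x : Fin (m + 3) → ℂ) :
    (matT (m + 3) d b₁ b₂ ε *ᵥ x) 1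
      = -(1 / (√3 : ℝ)) * x 0 + (√3 : ℝ) * d * x 2 := by
  rw [matT_mulVec, padZero_mulVec, Finset.sum_eq_zero]
  · simp [matB]
  · intro k hk
    have := Finset.mem_Icc.1 hk
    simp; omega

/-- The part of `T x` that vanishes with `ε`: the tail of `x` is mapped by an upper bidiagonal
matrix. -/
def tailMap (ε : ℝ) (t : ℕ → ℂ) (j : ℕ) : ℂ :=
  (if j = 0 then (ε : ℂ) else (ε : ℂ) ^ j) * t j + (ε : ℂ) ^ (j + 1) * t (j + 1)

theorem sum_Icc_eq_tailMap (m j : ℕ) (hj : j ≤ m) (ε : ℝ) (x : Fin (m + 3) → ℂ) :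
    (if j = 0 then (ε : ℂ) * extendZero x 2 else 0) + ∑ k ∈ Finset.Icc 1 m, (ε : ℂ) ^ k *
        ((if j + 2 + 1 = k + 2 then extendZero x (k + 2) else 0)
          + if j + 2 + 1 = k + 3 then extendZero x (k + 2) else 0)
      = tailMap ε (fun j => extendZero x (j + 2)) j := by
  simp only [mul_add, Finset.sum_add_distrib, mul_ite, mul_zero]
  have h1 : ∑ k ∈ Finset.Icc 1 m, (if j + 2 + 1 = k + 2 then (ε : ℂ) ^ k * extendZero x (k + 2)
      else 0) = (ε : ℂ) ^ (j + 1) * extendZero x (j + 1 + 2) := by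
    have : ∀ k, (j + 2 + 1 = k + 2) = (j + 1 = k) := fun k => by simp
    simp only [this, Finset.sum_ite_eq]
    split_ifs with h
    · rfl
    -- Here j = m: the sum has no term k = m + 1, and the extended vector vanishes at that index as
    -- well.
    · rw [extendZero_of_le x (by simp at h; omega), mul_zero]
  have h2 : ∑ k ∈ Finset.Icc 1 m, (if j + 2 + 1 = k + 3 then (ε : ℂ) ^ k * extendZero x (k + 2)
      else 0) = if j = 0 then 0 else (ε : ℂ) ^ j * extendZero x (j + 2) := by
    have : ∀ k, (j + 2 + 1 = k + 3) = (j = k) := fun k => by simp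
    simp only [this, Finset.sum_ite_eq, Finset.mem_Icc]
    split_ifs <;> first | rfl | omega
  rw [h1, h2, tailMap]
  split_ifs with h
  · subst h; ring
  · ring

theorem matT_mulVec_two (m : ℕ) (d b₁ b₂ ε : ℝ) (x : Fin (m + 3) → ℂ) :
    (matT (m + 3) d b₁ b₂ ε *ᵥ x) 2
      = d * x 0 - (√3 : ℝ) * d * x 1 + 3 / 2 * d ^ 2 * x 2
        + tailMap ε (fun j => extendZero x (j + 2)) 0 := by
  rw [matT_mulVec, padZero_mulVec, ← sum_Icc_eq_tailMap m 0 (by omega)]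
  have : extendZero x 2 = x 2 := by rw [fin_two_eq_mk, extendZero_of_lt]
  have hB2 : (⟨2, by norm_num⟩ : Fin 3) = 2 := rfl
  rw [this, show ((2 : Fin (m + 3)) : ℕ) = 2 from
    Nat.mod_eq_of_lt (show 2 < m + 3 by omega),
    dif_pos (by norm_num)]
  simp [matB]
  ring

theorem matT_mulVec_add_three (m : ℕ) (d b₁ b₂ ε : ℝ) (x : Fin (m + 3) → ℂ) (j : ℕ)
    (h : j + 3 < m + 3) :
    (matT (m + 3) d b₁ b₂ ε *ᵥ x) ⟨j + 3, h⟩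
      = tailMap ε (fun j => extendZero x (j + 2)) (j + 1) := by
  rw [matT_mulVec, padZero_mulVec, ← sum_Icc_eq_tailMap m (j + 1) (by omega)]
  simp

/-! ### Estimates for the bidiagonal tail -/

theorem norm_tailMap_le {ε : ℝ} (h0 : 0 < ε) (h1 : ε ≤ 1) (t : ℕ → ℂ) (j : ℕ) :
    ‖tailMap ε t j‖ ≤ ε * (‖t j‖ + ‖t (j + 1)‖) := by
  have hp : ∀ k : ℕ, ε ^ (k + 1) ≤ ε := fun k => by
    simpa using pow_le_pow_of_le_one h0.le h1 (show 1 ≤ k + 1 by omega)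
  have ha : ‖(if j = 0 then (ε : ℂ) else (ε : ℂ) ^ j)‖ ≤ ε := by
    rcases j with _ | j
    · simp [abs_of_pos h0]
    · simpa [abs_of_pos h0] using hp j
  have hb : ‖(ε : ℂ) ^ (j + 1)‖ ≤ ε := by simpa [abs_of_pos h0] using hp j
  calc _ ≤ _ := norm_add_le _ _
    _ ≤ ε * ‖t j‖ + ε * ‖t (j + 1)‖ := by
      rw [norm_mul, norm_mul]; gcongr
    _ = _ := by ring

theorem sum_range_shift_le (f : ℕ → ℝ) (hf : ∀ j, 0 ≤ f j) {m : ℕ} (hm : f (m + 1) = 0) :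
    ∑ j ∈ Finset.range (m + 1), f (j + 1) ≤ ∑ j ∈ Finset.range (m + 1), f j := by
  have h1 := Finset.sum_range_succ' f (m + 1)
  have h2 := Finset.sum_range_succ f (m + 1)
  linarith [hf 0]

theorem sum_normSq_tailMap_le {ε : ℝ} (h0 : 0 < ε) (h1 : ε ≤ 1) {t : ℕ → ℂ} {m : ℕ}
    (ht : t (m + 1) = 0) :
    ∑ j ∈ Finset.range (m + 1), ‖tailMap ε t j‖ ^ 2
      ≤ 4 * ε ^ 2 * ∑ j ∈ Finset.range (m + 1), ‖t j‖ ^ 2 := by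
  have hs := sum_range_shift_le (fun j => ‖t j‖ ^ 2) (fun j => by positivity) (m := m) (by simp [ht])
  calc _ ≤ ∑ j ∈ Finset.range (m + 1), 2 * ε ^ 2 * (‖t j‖ ^ 2 + ‖t (j + 1)‖ ^ 2) := by
        refine Finset.sum_le_sum fun j _ => ?_
        calc _ ≤ (ε * (‖t j‖ + ‖t (j + 1)‖)) ^ 2 := by
              gcongr; exact norm_tailMap_le h0 h1 t j
          _ ≤ _ := by nlinarith [mul_nonneg (sq_nonneg ε) (sq_nonneg (‖t j‖ - ‖t (j + 1)‖))]
    _ = 2 * ε ^ 2 * (∑ j ∈ Finset.range (m + 1), ‖t j‖ ^ 2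
          + ∑ j ∈ Finset.range (m + 1), ‖t (j + 1)‖ ^ 2) := by
        rw [← Finset.mul_sum, Finset.sum_add_distrib]
    _ ≤ _ := by nlinarith [sq_nonneg ε]

theorem norm_sum_conj_mul_tailMap_le {ε : ℝ} (h0 : 0 < ε) (h1 : ε ≤ 1) {t : ℕ → ℂ} {m : ℕ}
    (ht : t (m + 1) = 0) :
    ‖∑ j ∈ Finset.range (m + 1), star (t j) * tailMap ε t j‖
      ≤ 2 * ε * ∑ j ∈ Finset.range (m + 1), ‖t j‖ ^ 2 := by
  have hs := sum_range_shift_le (fun j => ‖t j‖ ^ 2) (fun j => by positivity) (m := m) (by simp [ht])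
  calc _ ≤ ∑ j ∈ Finset.range (m + 1), ε * (3 / 2 * ‖t j‖ ^ 2 + 1 / 2 * ‖t (j + 1)‖ ^ 2) := by
        refine norm_sum_le_of_le _ fun j _ => ?_
        rw [norm_mul, norm_star]
        calc _ ≤ ‖t j‖ * (ε * (‖t j‖ + ‖t (j + 1)‖)) := by
              gcongr; exact norm_tailMap_le h0 h1 t j
          _ ≤ _ := by nlinarith [mul_nonneg h0.le (sq_nonneg (‖t j‖ - ‖t (j + 1)‖))]
    _ = ε * (3 / 2 * ∑ j ∈ Finset.range (m + 1), ‖t j‖ ^ 2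
          + 1 / 2 * ∑ j ∈ Finset.range (m + 1), ‖t (j + 1)‖ ^ 2) := by
        rw [← Finset.mul_sum, Finset.sum_add_distrib, Finset.mul_sum, Finset.mul_sum]
    _ ≤ _ := by nlinarith

theorem re_star_mul_tailMap (ε : ℝ) (t : ℕ → ℂ) (j : ℕ) :
    (star (t j) * tailMap ε t j).re = (if j = 0 then ε else ε ^ j) * ‖t j‖ ^ 2
      + ε ^ (j + 1) * (star (t j) * t (j + 1)).re := by
  have : star (t j) * tailMap ε t j
      = ((if j = 0 then ε else ε ^ j : ℝ) : ℂ) * ((‖t j‖ ^ 2 : ℝ) : ℂ)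
        + ((ε ^ (j + 1) : ℝ) : ℂ) * (star (t j) * t (j + 1)) := by
    have h := Complex.conj_mul' (t j)
    simp only [tailMap, Complex.star_def]
    push_cast
    rw [← h]
    split_ifs <;> push_cast <;> ring
  rw [this, Complex.add_re, Complex.re_ofReal_mul, Complex.re_ofReal_mul, Complex.ofReal_re]

theorem neg_le_re_star_mul (a b : ℂ) :
    -(1 / 2 * (‖a‖ ^ 2 + ‖b‖ ^ 2)) ≤ (star a * b).re := by
  have h1 := Complex.abs_re_le_norm (star a * b)
  rw [norm_mul, norm_star] at h1
  have h2 := neg_abs_le (star a * b).re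
  nlinarith [sq_nonneg (‖a‖ - ‖b‖)]

/-- The diagonal weights are ε, ε, ε², …. For j ≥ 1, half of the weight ε^j absorbs the coupling to
j - 1 and the other half the coupling to j + 1, since ε^(j+1) ≤ ε^j. Only the last boundary term
survives, and it vanishes for a sequence that ends there. -/
theorem neg_le_re_sum_star_mul_tailMap {ε : ℝ} (h0 : 0 < ε) (h1 : ε ≤ 1) (t : ℕ → ℂ) (m : ℕ) :
    -(1 / 2 * ε ^ (m + 1) * ‖t (m + 1)‖ ^ 2)
      ≤ (∑ j ∈ Finset.range (m + 1), star (t j) * tailMap ε t j).re := by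
  induction m with
  | zero =>
    rw [Finset.sum_range_one, re_star_mul_tailMap]
    have := neg_le_re_star_mul (t 0) (t 1)
    simp only [if_true, zero_add, pow_one]
    nlinarith [sq_nonneg ‖t 0‖]
  | succ m ih =>
    rw [Finset.sum_range_succ, Complex.add_re, re_star_mul_tailMap]
    have h := neg_le_re_star_mul (t (m + 1)) (t (m + 1 + 1))
    have hp : 0 < ε ^ (m + 1) := pow_pos h0 _
    have hq : ε ^ (m + 1 + 1) ≤ ε ^ (m + 1) := pow_le_pow_of_le_one h0.le h1 (by omega)
    have hq0 : 0 < ε ^ (m + 1 + 1) := pow_pos h0 _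
    simp only [Nat.add_eq_zero_iff, one_ne_zero, and_false, if_false]
    have := mul_le_mul_of_nonneg_left h hq0.le
    nlinarith [mul_le_mul_of_nonneg_right hq (sq_nonneg ‖t (m + 1)‖)]

theorem re_sum_star_mul_tailMap_nonneg {ε : ℝ} (h0 : 0 < ε) (h1 : ε ≤ 1) {t : ℕ → ℂ} {m : ℕ}
    (ht : t (m + 1) = 0) :
    0 ≤ (∑ j ∈ Finset.range (m + 1), star (t j) * tailMap ε t j).re := by
  simpa [ht] using neg_le_re_sum_star_mul_tailMap h0 h1 t m

/-! ### Numerical range of the leading block -/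

/-- Used with a = |x|², β = |y|², σ = (9/4) d² |z|² and ρ the cross term of x and z; then 20 σ = 45
d² |z|². -/
theorem disc_polynomial_ineq {a β ρ σ : ℝ} (ha : 0 ≤ a) (hβ : 0 ≤ β) (hσ : 0 ≤ σ)
    (hρ : ρ ^ 2 ≤ a * σ) :
    2 * (4 / 9 * (a + 2 * ρ + σ) ^ 2 + 4 / 3 * (a - 4 * ρ + 4 * σ) * β)
      ≤ (a + β + 20 * σ) ^ 2 := by
  -- The difference of the two sides is a quadratic in β with vertex (a - 16ρ - 44σ)/3. If the
  -- vertex is nonnegative, completing the square leaves (8/9)(54aσ - 180ρσ + 207σ² - 36ρ²), and ρ²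
  -- ≤ aσ bounds the bracket below by the product in `h1`.
  rcases le_total 0 (a - 16 * ρ - 44 * σ) with h | h
  · have h1 : 0 ≤ σ * (18 * a - 180 * ρ + 207 * σ) := mul_nonneg hσ (by linarith)
    nlinarith [sq_nonneg (β + (a + 20 * σ) - 4 / 3 * (a - 4 * ρ + 4 * σ))]
  -- Otherwise the difference increases on β ≥ 0 and β = 0 is the worst case; there (8/9)(21/20)² =
  -- 0.98 < 1 suffices.
  · have h2 : 2 * ρ ≤ a / 20 + 20 * σ := by
      refine abs_le_of_sq_le_sq' ?_ (by positivity) |>.2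
      nlinarith [sq_nonneg (a / 20 - 20 * σ)]
    have h2' : 0 ≤ a + 2 * ρ + σ := by
      have := (abs_le_of_sq_le_sq' (a := 2 * ρ) (b := a + σ)
        (by nlinarith [sq_nonneg (a - σ)]) (by positivity)).1
      linarith
    have h3 : 20 * (a + 2 * ρ + σ) ≤ 21 * (a + 20 * σ) := by linarith
    have h4 : (20 * (a + 2 * ρ + σ)) ^ 2 ≤ (21 * (a + 20 * σ)) ^ 2 :=
      pow_le_pow_left₀ (by linarith) h3 2
    nlinarith [mul_nonneg hβ (neg_nonneg.2 h), sq_nonneg β, sq_nonneg (a + 2 * ρ + σ)]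

/-- The quadratic form of the leading `3 × 3` block at `ε = 0`. -/
noncomputable def leadingForm (d : ℝ) (x y z : ℂ) : ℂ :=
  star x * (2 / 3 * x + 1 / (√3 : ℝ) * y + d * z)
    + star y * (-(1 / (√3 : ℝ)) * x + (√3 : ℝ) * d * z)
    + star z * (d * x - (√3 : ℝ) * d * y + 3 / 2 * d ^ 2 * z)

/-- The couplings of y are skew-Hermitian and drop out. The Hermitian form left in x and z has rank
one because (2/3)(3d²/2) = d², which explains the entry 3d²/2. -/
theorem leadingForm_re (d : ℝ) (x y z : ℂ) :
    (leadingForm d x y z).re = 2 / 3 * ‖x + 3 / 2 * d * z‖ ^ 2 := by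
  rw [← Complex.normSq_eq_norm_sq]
  simp [leadingForm, Complex.normSq_apply, pow_two]
  ring

theorem one_div_sqrt_three : 1 / √3 = √3 / 3 := by
  have h : √3 * √3 = 3 := Real.mul_self_sqrt (by norm_num)
  have h' : √3 ≠ 0 := by positivity
  field_simp
  linarith

theorem leadingForm_im (d : ℝ) (x y z : ℂ) :
    (leadingForm d x y z).im = 2 / 3 * √3 * (star (x - 3 * d * z) * y).im := by
  have : (1 : ℂ) / (√3 : ℝ) = ((√3 / 3 : ℝ) : ℂ) := by
    rw [← one_div_sqrt_three]; push_cast; rfl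
  rw [leadingForm, this]
  simp [pow_two]
  ring

theorem norm_leadingForm_le (d : ℝ) (x y z : ℂ) :
    √2 * ‖leadingForm d x y z‖ ≤ ‖x‖ ^ 2 + ‖y‖ ^ 2 + 45 * d ^ 2 * ‖z‖ ^ 2 := by
  have h3 : √3 ^ 2 = 3 := Real.sq_sqrt (by norm_num)
  have h2 : √2 ^ 2 = 2 := Real.sq_sqrt (by norm_num)
  have him : (star (x - 3 * d * z) * y).im ^ 2 ≤ ‖x - 3 * d * z‖ ^ 2 * ‖y‖ ^ 2 := by
    have := Complex.abs_im_le_norm (star (x - 3 * d * z) * y)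
    rw [norm_mul, norm_star] at this
    calc _ = |(star (x - 3 * d * z) * y).im| ^ 2 := (sq_abs _).symm
      _ ≤ (‖x - 3 * d * z‖ * ‖y‖) ^ 2 := by gcongr
      _ = _ := by ring
  set ρ : ℝ := 3 / 2 * d * (x.re * z.re + x.im * z.im) with hρ
  have e1 : ‖x + 3 / 2 * d * z‖ ^ 2 = ‖x‖ ^ 2 + 2 * ρ + 9 / 4 * d ^ 2 * ‖z‖ ^ 2 := by
    simp only [← Complex.normSq_eq_norm_sq, Complex.normSq_apply, hρ]
    simp
    ring
  have e2 : ‖x - 3 * d * z‖ ^ 2 = ‖x‖ ^ 2 - 4 * ρ + 4 * (9 / 4 * d ^ 2 * ‖z‖ ^ 2) := by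
    simp only [← Complex.normSq_eq_norm_sq, Complex.normSq_apply, hρ]
    simp
    ring
  have hcs : ρ ^ 2 ≤ ‖x‖ ^ 2 * (9 / 4 * d ^ 2 * ‖z‖ ^ 2) := by
    simp only [← Complex.normSq_eq_norm_sq, Complex.normSq_apply, hρ]
    nlinarith [sq_nonneg (d * (x.re * z.im - x.im * z.re))]
  have key := disc_polynomial_ineq (sq_nonneg ‖x‖) (sq_nonneg ‖y‖)
    (show 0 ≤ 9 / 4 * d ^ 2 * ‖z‖ ^ 2 by positivity) hcs
  refine abs_le_of_sq_le_sq' ?_ (by positivity) |>.2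
  rw [mul_pow, h2, ← Complex.normSq_eq_norm_sq, Complex.normSq_apply, leadingForm_re,
    leadingForm_im]
  rw [e2] at him
  rw [e1]
  nlinarith

/-! ### Norm of the leading block -/

/-- The coordinate of `(x, y)` in the direction orthogonal to the norm-attaining vector. -/
noncomputable def defectCoord (x y : ℂ) : ℂ := 1 / 2 * x - (√3 : ℝ) / 2 * y

/-- The 2×2 block has singular values 1 (along f) and 1/3 (along r). The third row annihilates f and
the third column is orthogonal to g, so z interacts only with r. -/
theorem leading_block_normSq_le {d : ℝ} (hd0 : 0 ≤ d) (hd : 45 * d ^ 2 < 1) (x y z v : ℂ) :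
    ‖2 / 3 * x + 1 / (√3 : ℝ) * y + d * z‖ ^ 2 + ‖-(1 / (√3 : ℝ)) * x + (√3 : ℝ) * d * z‖ ^ 2
      + ‖d * x - (√3 : ℝ) * d * y + 3 / 2 * d ^ 2 * z + v‖ ^ 2
      ≤ ‖x‖ ^ 2 + ‖y‖ ^ 2 - 1 / 4 * ‖defectCoord x y‖ ^ 2 + 3 / 4 * ‖z‖ ^ 2 + 3 * ‖v‖ ^ 2 := by
  set r := defectCoord x y with hr
  have hs3 : √3 * √3 = 3 := Real.mul_self_sqrt (by norm_num)
  have hc : (1 : ℂ) / (√3 : ℝ) = ((√3 / 3 : ℝ) : ℂ) := by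
    rw [← one_div_sqrt_three]; push_cast; rfl
  have e1 : ‖2 / 3 * x + 1 / (√3 : ℝ) * y + d * z‖ ^ 2
      + ‖-(1 / (√3 : ℝ)) * x + (√3 : ℝ) * d * z‖ ^ 2
      = ‖x‖ ^ 2 + ‖y‖ ^ 2 - ‖r‖ ^ 2 + ‖-(r / 3) + 2 * d * z‖ ^ 2 := by
    rw [hc, hr]
    simp only [← Complex.normSq_eq_norm_sq, Complex.normSq_apply, defectCoord]
    simp [-Complex.ofReal_div]
    ring_nf
    rw [show √3 ^ 2 = 3 by rw [pow_two, hs3]]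
    ring
  have e2 : d * x - (√3 : ℝ) * d * y + 3 / 2 * d ^ 2 * z = 2 * d * r + 3 / 2 * d ^ 2 * z := by
    rw [hr, defectCoord]; ring
  -- 45 (3/20)² = 1.0125 > 1.
  have hd' : d ≤ 3 / 20 := by nlinarith
  have n1 : ‖-(r / 3) + 2 * d * z‖ ≤ 1 / 3 * ‖r‖ + 2 * d * ‖z‖ := by
    refine (norm_add_le _ _).trans (le_of_eq ?_)
    simp [abs_of_nonneg hd0]
    ring
  have n2 : ‖2 * d * r + 3 / 2 * d ^ 2 * z‖ ≤ 2 * d * ‖r‖ + 3 / 2 * d ^ 2 * ‖z‖ := by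
    refine (norm_add_le _ _).trans (le_of_eq ?_)
    simp [abs_of_nonneg hd0]
  -- The weights favour the leading term; v will be O(ε), so its factor 3 is harmless.
  have n3 : ‖2 * d * r + 3 / 2 * d ^ 2 * z + v‖ ^ 2
      ≤ 3 / 2 * ‖2 * d * r + 3 / 2 * d ^ 2 * z‖ ^ 2 + 3 * ‖v‖ ^ 2 := by
    set w := 2 * d * r + 3 / 2 * d ^ 2 * z
    calc _ ≤ (‖w‖ + ‖v‖) ^ 2 := by gcongr; exact norm_add_le _ _
      _ ≤ _ := by nlinarith [sq_nonneg (‖w‖ - 2 * ‖v‖)]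
  have q1 := pow_le_pow_left₀ (norm_nonneg _) n1 2
  have q2 := pow_le_pow_left₀ (norm_nonneg _) n2 2
  have hmain : (1 / 3 * ‖r‖ + 2 * d * ‖z‖) ^ 2
      + 3 / 2 * (2 * d * ‖r‖ + 3 / 2 * d ^ 2 * ‖z‖) ^ 2 ≤ 3 / 4 * ‖r‖ ^ 2 + 3 / 4 * ‖z‖ ^ 2 := by
    have g1 : (1 / 3 * ‖r‖ + 2 * d * ‖z‖) ≤ 1 / 3 * ‖r‖ + 3 / 10 * ‖z‖ := by
      nlinarith [norm_nonneg z]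
    have g2 : (2 * d * ‖r‖ + 3 / 2 * d ^ 2 * ‖z‖) ≤ 3 / 10 * ‖r‖ + 1 / 10 * ‖z‖ := by
      nlinarith [norm_nonneg z, norm_nonneg r]
    have g1' := pow_le_pow_left₀ (by positivity) g1 2
    have g2' := pow_le_pow_left₀ (by positivity) g2 2
    nlinarith [sq_nonneg (‖r‖ - ‖z‖)]
  rw [e1, e2]
  linarith

/-! ### Estimates for the full matrix -/

/-- The coordinates of `x` from the third one on, extended by zero. -/
def tailSeq {n : ℕ} (x : Fin n → ℂ) (j : ℕ) : ℂ := extendZero x (j + 2)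

theorem tailSeq_zero {m : ℕ} (x : Fin (m + 3) → ℂ) : tailSeq x 0 = x 2 := by
  rw [tailSeq, fin_two_eq_mk, extendZero_of_lt]

theorem tailSeq_of_lt {m : ℕ} (x : Fin (m + 3) → ℂ) {j : ℕ} (h : j + 2 < m + 3) :
    tailSeq x j = x ⟨j + 2, h⟩ := extendZero_of_lt x h

theorem tailSeq_last {m : ℕ} (x : Fin (m + 3) → ℂ) : tailSeq x (m + 1) = 0 :=
  extendZero_of_le x (by omega)

theorem sum_normSq_eq {m : ℕ} (x : Fin (m + 3) → ℂ) :
    ∑ i, ‖x i‖ ^ 2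
      = ‖x 0‖ ^ 2 + (‖x 1‖ ^ 2 + ∑ j ∈ Finset.range (m + 1), ‖tailSeq x j‖ ^ 2) := by
  rw [sum_fin_add_three]
  congr 2
  refine Finset.sum_congr rfl fun j hj => ?_
  have h : j + 2 < m + 3 := by simp at hj; omega
  rw [dif_pos h, tailSeq_of_lt x h]

theorem normSq_tail_zero_le {m : ℕ} (x : Fin (m + 3) → ℂ) :
    ‖x 2‖ ^ 2 ≤ ∑ j ∈ Finset.range (m + 1), ‖tailSeq x j‖ ^ 2 := by
  rw [← tailSeq_zero x]
  exact Finset.single_le_sum (f := fun j => ‖tailSeq x j‖ ^ 2) (fun j _ => by positivity)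
    (Finset.mem_range.2 (by omega))

theorem star_dotProduct_matT_mulVec (m : ℕ) (d b₁ b₂ ε : ℝ) (x : Fin (m + 3) → ℂ) :
    star x ⬝ᵥ (matT (m + 3) d b₁ b₂ ε *ᵥ x) = leadingForm d (x 0) (x 1) (x 2)
      + ∑ j ∈ Finset.range (m + 1), star (tailSeq x j) * tailMap ε (tailSeq x) j := by
  rw [dotProduct, sum_fin_add_three, Finset.sum_range_succ', Finset.sum_range_succ' _ m,
    dif_pos (by omega), tailSeq_zero, ← fin_two_eq_mk, matT_mulVec_zero, matT_mulVec_one,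
    matT_mulVec_two, leadingForm]
  have : ∀ j ∈ Finset.range m, (if h : j + 1 + 2 < m + 3 then
      star x ⟨j + 1 + 2, h⟩ * (matT (m + 3) d b₁ b₂ ε *ᵥ x) ⟨j + 1 + 2, h⟩ else 0)
      = star (tailSeq x (j + 1)) * tailMap ε (tailSeq x) (j + 1) := fun j hj => by
    have h : j + 1 + 2 < m + 3 := by simp at hj; omega
    rw [dif_pos h, matT_mulVec_add_three, tailSeq_of_lt x h]
    rfl
  rw [Finset.sum_congr rfl this]
  simp only [Pi.star_apply, show (fun j => extendZero x (j + 2)) = tailSeq x from rfl]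
  ring

theorem sum_normSq_matT_mulVec (m : ℕ) (d b₁ b₂ ε : ℝ) (x : Fin (m + 3) → ℂ) :
    ∑ i, ‖(matT (m + 3) d b₁ b₂ ε *ᵥ x) i‖ ^ 2
      = ‖2 / 3 * x 0 + 1 / (√3 : ℝ) * x 1 + d * x 2‖ ^ 2
        + ‖-(1 / (√3 : ℝ)) * x 0 + (√3 : ℝ) * d * x 2‖ ^ 2
        + ‖d * x 0 - (√3 : ℝ) * d * x 1 + 3 / 2 * d ^ 2 * x 2 + tailMap ε (tailSeq x) 0‖ ^ 2
        + ∑ j ∈ Finset.range m, ‖tailMap ε (tailSeq x) (j + 1)‖ ^ 2 := by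
  rw [sum_fin_add_three, Finset.sum_range_succ',
    dif_pos (by omega), ← fin_two_eq_mk, matT_mulVec_zero, matT_mulVec_one,
    matT_mulVec_two]
  have : ∀ j ∈ Finset.range m, (if h : j + 1 + 2 < m + 3 then
      ‖(matT (m + 3) d b₁ b₂ ε *ᵥ x) ⟨j + 1 + 2, h⟩‖ ^ 2 else 0)
      = ‖tailMap ε (tailSeq x) (j + 1)‖ ^ 2 := fun j hj => by
    have h : j + 1 + 2 < m + 3 := by simp at hj; omega
    rw [dif_pos h, matT_mulVec_add_three]
    rfl
  rw [Finset.sum_congr rfl this]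
  simp only [show (fun j => extendZero x (j + 2)) = tailSeq x from rfl]
  ring

/-- The tail keeps at most 3/4 + 12ε² ≤ 0.87 of its squared norm. The explicit loss, beyond
contractivity, identifies the norm-attaining vectors. -/
theorem sum_normSq_matT_mulVec_le (m : ℕ) {d ε : ℝ} (b₁ b₂ : ℝ) (hd0 : 0 ≤ d)
    (hd : 45 * d ^ 2 < 1) (h0 : 0 < ε) (h1 : ε ≤ 1 / 10) (x : Fin (m + 3) → ℂ) :
    ∑ i, ‖(matT (m + 3) d b₁ b₂ ε *ᵥ x) i‖ ^ 2 ≤ ∑ i, ‖x i‖ ^ 2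
      - 1 / 10 * (‖defectCoord (x 0) (x 1)‖ ^ 2
        + ∑ j ∈ Finset.range (m + 1), ‖tailSeq x j‖ ^ 2) := by
  rw [sum_normSq_matT_mulVec, sum_normSq_eq]
  have k1 := leading_block_normSq_le hd0 hd (x 0) (x 1) (x 2) (tailMap ε (tailSeq x) 0)
  have k2 := sum_normSq_tailMap_le h0 (by linarith) (tailSeq_last x)
  have k3 := normSq_tail_zero_le x
  have k4 : 0 ≤ ∑ j ∈ Finset.range m, ‖tailMap ε (tailSeq x) (j + 1)‖ ^ 2 :=
    Finset.sum_nonneg fun j _ => by positivity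
  have k5 : ε ^ 2 ≤ 1 / 100 := by nlinarith
  have k6 := mul_le_mul_of_nonneg_right k5 ((sq_nonneg _).trans k3)
  rw [Finset.sum_range_succ'] at k2
  nlinarith [sq_nonneg ‖defectCoord (x 0) (x 1)‖]

theorem norm_star_dotProduct_matT_mulVec_le (m : ℕ) {d ε : ℝ} (b₁ b₂ : ℝ)
    (h0 : 0 < ε) (h1 : ε ≤ 1) (h2 : 4 * ε ≤ 1 - 45 * d ^ 2) (x : Fin (m + 3) → ℂ) :
    √2 * ‖star x ⬝ᵥ (matT (m + 3) d b₁ b₂ ε *ᵥ x)‖ ≤ ∑ i, ‖x i‖ ^ 2 := by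
  rw [star_dotProduct_matT_mulVec, sum_normSq_eq]
  have k1 := norm_leadingForm_le d (x 0) (x 1) (x 2)
  have k2 := norm_sum_conj_mul_tailMap_le h0 h1 (tailSeq_last x)
  have k3 := normSq_tail_zero_le x
  set s := ∑ j ∈ Finset.range (m + 1), star (tailSeq x j) * tailMap ε (tailSeq x) j
  set N := ∑ j ∈ Finset.range (m + 1), ‖tailSeq x j‖ ^ 2
  have hN : 0 ≤ N := (sq_nonneg _).trans k3
  have hs2 : √2 ≤ 2 := by rw [Real.sqrt_le_left (by norm_num)]; norm_num
  have k4 : √2 * ‖s‖ ≤ 4 * ε * N := by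
    calc _ ≤ 2 * (2 * ε * N) := by gcongr
      _ = _ := by ring
  have k5 : √2 * ‖leadingForm d (x 0) (x 1) (x 2) + s‖
      ≤ √2 * ‖leadingForm d (x 0) (x 1) (x 2)‖ + √2 * ‖s‖ := by
    rw [← mul_add]; gcongr; exact norm_add_le _ _
  have k6 : 45 * d ^ 2 * ‖x 2‖ ^ 2 ≤ 45 * d ^ 2 * N := by gcongr
  have k7 := mul_le_mul_of_nonneg_right h2 hN
  linarith

theorem re_star_dotProduct_matT_mulVec_nonneg (m : ℕ) {ε : ℝ} (d b₁ b₂ : ℝ)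
    (h0 : 0 < ε) (h1 : ε ≤ 1) (x : Fin (m + 3) → ℂ) :
    0 ≤ (star x ⬝ᵥ (matT (m + 3) d b₁ b₂ ε *ᵥ x)).re := by
  rw [star_dotProduct_matT_mulVec, Complex.add_re, leadingForm_re]
  exact add_nonneg (by positivity) (re_sum_star_mul_tailMap_nonneg h0 h1 (tailSeq_last x))

/-! ### From quadratic forms to range, norm and radius -/

theorem posSemidef_add_conjTranspose {ι : Type*} [Fintype ι] {M : Matrix ι ι ℂ}
    (h : ∀ x : ι → ℂ, 0 ≤ (star x ⬝ᵥ (M *ᵥ x)).re) : (M + Mᴴ).PosSemidef := by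
  rw [Matrix.posSemidef_iff_dotProduct_mulVec]
  refine ⟨by simp [Matrix.IsHermitian, add_comm], fun x => ?_⟩
  have : star x ⬝ᵥ (Mᴴ *ᵥ x) = star (star x ⬝ᵥ (M *ᵥ x)) := by
    rw [← Matrix.star_dotProduct_star, Matrix.star_mulVec, star_star, Matrix.dotProduct_mulVec]
  rw [Matrix.add_mulVec, dotProduct_add, this, Complex.star_def, Complex.add_conj]
  exact_mod_cast mul_nonneg zero_le_two (h x)

theorem inner_matrixOp {ι : Type*} [Fintype ι] [DecidableEq ι] (M : Matrix ι ι ℂ)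
    (x : EuclideanSpace ℂ ι) : inner ℂ x (matrixOp M x) = star (x : ι → ℂ) ⬝ᵥ (M *ᵥ x) := by
  rw [EuclideanSpace.inner_eq_star_dotProduct, dotProduct_comm]
  rfl

theorem numericalRange_subset_sector {ι : Type*} [Fintype ι] [DecidableEq ι] {M : Matrix ι ι ℂ}
    (h : ∀ x : ι → ℂ, 0 ≤ (star x ⬝ᵥ (M *ᵥ x)).re) :
    numericalRange M ⊆ sector (Real.pi / 2) := by
  rintro _ ⟨x, -, rfl⟩
  rw [inner_matrixOp]
  exact ⟨h x, by simpa using h x⟩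

theorem matrixNorm_eq_one {ι : Type*} [Fintype ι] [DecidableEq ι] {M : Matrix ι ι ℂ}
    (h : ∀ x : ι → ℂ, ∑ i, ‖(M *ᵥ x) i‖ ^ 2 ≤ ∑ i, ‖x i‖ ^ 2) {v : ι → ℂ} (hv : v ≠ 0)
    (hv' : ∑ i, ‖(M *ᵥ v) i‖ ^ 2 = ∑ i, ‖v i‖ ^ 2) : matrixNorm M = 1 := by
  refine le_antisymm (ContinuousLinearMap.opNorm_le_bound _ zero_le_one fun x => ?_) ?_
  · rw [one_mul, EuclideanSpace.norm_eq, EuclideanSpace.norm_eq]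
    exact Real.sqrt_le_sqrt (h x)
  · have h1 := (matrixOp M).le_opNorm (WithLp.toLp 2 v)
    have h2 : ‖matrixOp M (WithLp.toLp 2 v)‖ = ‖(WithLp.toLp 2 v : EuclideanSpace ℂ ι)‖ := by
      rw [EuclideanSpace.norm_eq, EuclideanSpace.norm_eq]
      exact congrArg Real.sqrt hv'
    have h3 : 0 < ‖(WithLp.toLp 2 v : EuclideanSpace ℂ ι)‖ := by
      rw [norm_pos_iff]
      simpa using hv
    rw [h2] at h1
    exact le_of_mul_le_mul_right (by rwa [one_mul]) h3

theorem numericalRadius_eq {ι : Type*} [Fintype ι] [DecidableEq ι] {M : Matrix ι ι ℂ} {r : ℝ}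
    (h : ∀ x : ι → ℂ, ‖star x ⬝ᵥ (M *ᵥ x)‖ ≤ r * ∑ i, ‖x i‖ ^ 2) {v : ι → ℂ}
    (hv : ∑ i, ‖v i‖ ^ 2 = 1) (hv' : ‖star v ⬝ᵥ (M *ᵥ v)‖ = r) : numericalRadius M = r := by
  refine IsGreatest.csSup_eq ⟨⟨_, ⟨WithLp.toLp 2 v, ?_, inner_matrixOp _ _⟩, hv'⟩, ?_⟩
  · rw [EuclideanSpace.norm_eq]
    simpa using hv
  · rintro _ ⟨_, ⟨x, hx, rfl⟩, rfl⟩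
    have h1 := h x
    rw [← EuclideanSpace.norm_sq_eq, hx] at h1
    simp only [inner_matrixOp]
    simpa using h1

/-! ### Extremal vectors -/

/-- The vector `(a, b, 0, …, 0)`. -/
def leadingVec (m : ℕ) (a b : ℂ) : Fin (m + 3) → ℂ := a • Pi.single 0 1 + b • Pi.single 1 1

theorem leadingVec_zero (m : ℕ) (a b : ℂ) : leadingVec m a b 0 = a := by simp [leadingVec]

theorem leadingVec_one (m : ℕ) (a b : ℂ) : leadingVec m a b 1 = b := by simp [leadingVec]

theorem leadingVec_two (m : ℕ) (a b : ℂ) : leadingVec m a b 2 = 0 := by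
  simp [leadingVec, fin_two_eq_mk, Fin.ext_iff]

theorem tailSeq_leadingVec (m : ℕ) (a b : ℂ) : tailSeq (leadingVec m a b) = 0 := by
  ext j
  by_cases h : j + 2 < m + 3
  · rw [tailSeq_of_lt _ h]
    simp [leadingVec, Fin.ext_iff]
  · exact extendZero_of_le _ (by omega)

theorem eq_leadingVec {m : ℕ} {x : Fin (m + 3) → ℂ} (h : ∀ j, j < m + 1 → tailSeq x j = 0) :
    x = leadingVec m (x 0) (x 1) := by
  ext i
  obtain ⟨i, hi⟩ := i
  match i, hi with
  | 0, _ => exact (leadingVec_zero m _ _).symm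
  | 1, _ => exact (leadingVec_one m _ _).symm
  | j + 2, hi =>
    rw [← tailSeq_of_lt x hi, ← tailSeq_of_lt (leadingVec m _ _) hi, tailSeq_leadingVec, h j (by omega)]
    rfl

theorem tailMap_zero (ε : ℝ) : tailMap ε 0 = 0 := by
  ext j; simp [tailMap]

theorem sum_normSq_leadingVec (m : ℕ) (a b : ℂ) :
    ∑ i, ‖leadingVec m a b i‖ ^ 2 = ‖a‖ ^ 2 + ‖b‖ ^ 2 := by
  rw [sum_normSq_eq, tailSeq_leadingVec, leadingVec_zero, leadingVec_one]
  simp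

theorem matT_mulVec_leadingVec (m : ℕ) (d b₁ b₂ ε : ℝ) :
    matT (m + 3) d b₁ b₂ ε *ᵥ leadingVec m (√3 : ℝ) 1 = leadingVec m (√3 : ℝ) (-1) := by
  have hs : ((√3 : ℝ) : ℂ) * (√3 : ℝ) = 3 := by
    rw [← Complex.ofReal_mul, Real.mul_self_sqrt (by norm_num)]; norm_num
  have hs0 : ((√3 : ℝ) : ℂ) ≠ 0 := by
    rw [Complex.ofReal_ne_zero]; positivity
  ext i
  obtain ⟨i, hi⟩ := i
  have ht : (fun j => extendZero (leadingVec m (√3 : ℝ) 1) (j + 2)) = 0 :=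
    tailSeq_leadingVec m _ _
  match i, hi with
  | 0, _ =>
    refine (matT_mulVec_zero m d b₁ b₂ ε _).trans (Eq.trans ?_ (leadingVec_zero m _ _).symm)
    rw [leadingVec_zero, leadingVec_one, leadingVec_two]
    field_simp
    linear_combination -hs
  | 1, _ =>
    refine (matT_mulVec_one m d b₁ b₂ ε _).trans (Eq.trans ?_ (leadingVec_one m _ _).symm)
    rw [leadingVec_zero, leadingVec_two]
    field_simp
    ring
  | 2, _ =>
    rw [← fin_two_eq_mk]
    refine (matT_mulVec_two m d b₁ b₂ ε _).trans (Eq.trans ?_ (leadingVec_two m _ _).symm)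
    rw [leadingVec_zero, leadingVec_one, leadingVec_two, ht, tailMap_zero]
    simp
    ring
  | j + 3, hi =>
    rw [matT_mulVec_add_three, ht, tailMap_zero,
      ← tailSeq_of_lt (leadingVec m (√3 : ℝ) (-1)) (j := j + 1) hi, tailSeq_leadingVec]

theorem matrixNorm_matT (m : ℕ) {d ε : ℝ} (b₁ b₂ : ℝ) (hd0 : 0 ≤ d)
    (hd : 45 * d ^ 2 < 1) (h0 : 0 < ε) (h1 : ε ≤ 1 / 10) :
    matrixNorm (matT (m + 3) d b₁ b₂ ε) = 1 := by
  refine matrixNorm_eq_one (v := leadingVec m (√3 : ℝ) 1) (fun x => ?_) (fun h => ?_) ?_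
  · refine (sum_normSq_matT_mulVec_le m b₁ b₂ hd0 hd h0 h1 x).trans (sub_le_self _ ?_)
    have : 0 ≤ ∑ j ∈ Finset.range (m + 1), ‖tailSeq x j‖ ^ 2 :=
      Finset.sum_nonneg fun j _ => by positivity
    positivity
  · simpa [leadingVec_one] using congrFun h 1
  · rw [matT_mulVec_leadingVec, sum_normSq_leadingVec, sum_normSq_leadingVec, norm_neg]

theorem numericalRadius_matT (m : ℕ) {d ε : ℝ} (b₁ b₂ : ℝ)
    (h0 : 0 < ε) (h1 : ε ≤ 1) (h2 : 4 * ε ≤ 1 - 45 * d ^ 2) :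
    numericalRadius (matT (m + 3) d b₁ b₂ ε) = 1 / √2 := by
  have hs : √3 * √3 = 3 := Real.mul_self_sqrt (by norm_num)
  -- This unit vector gives the point (1 + i)/2, where the ellipse touches the circle.
  refine numericalRadius_eq (v := leadingVec m (√3 / 2 : ℝ) (Complex.I / 2)) (fun x => ?_) ?_ ?_
  · have := norm_star_dotProduct_matT_mulVec_le m b₁ b₂ h0 h1 h2 x
    rw [one_div, inv_mul_eq_div, le_div_iff₀ (by positivity)]
    linarith
  · rw [sum_normSq_leadingVec, Complex.norm_real, Real.norm_eq_abs, sq_abs]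
    simp
    nlinarith
  · rw [star_dotProduct_matT_mulVec, tailSeq_leadingVec, tailMap_zero, leadingVec_zero,
      leadingVec_one, leadingVec_two]
    have : leadingForm d (√3 / 2 : ℝ) (Complex.I / 2) 0 = 1 / 2 + 1 / 2 * Complex.I := by
      apply Complex.ext
      · rw [leadingForm_re, mul_zero, add_zero, Complex.norm_real, Real.norm_eq_abs, sq_abs]
        simp
        nlinarith
      · rw [leadingForm_im]
        simp
        nlinarith
    simp only [Pi.zero_apply, mul_zero, Finset.sum_const_zero, add_zero, this]
    rw [← sq_eq_sq₀ (norm_nonneg _) (by positivity), ← Complex.normSq_eq_norm_sq,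
      Complex.normSq_apply, div_pow, Real.sq_sqrt (by norm_num)]
    norm_num

/-! ### The adjoint on basis vectors and the commutant of `T` -/

/-- The `j`-th standard basis vector, or zero if `j` is out of range. -/
def basisVec (n j : ℕ) : Fin n → ℂ := if h : j < n then Pi.single ⟨j, h⟩ 1 else 0

theorem basisVec_dotProduct {n : ℕ} (j : ℕ) (x : Fin n → ℂ) :
    basisVec n j ⬝ᵥ x = extendZero x j := by
  by_cases h : j < n
  · simp [basisVec, h, extendZero_of_lt x h]
  · simp [basisVec, h, extendZero_of_le x (not_lt.1 h)]

theorem star_basisVec (n j : ℕ) : star (basisVec n j) = basisVec n j := by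
  by_cases h : j < n
  · simp [basisVec, h]
  · simp [basisVec, h]

theorem conjTranspose_mulVec_basisVec {n : ℕ} (M : Matrix (Fin n) (Fin n) ℂ) {j : ℕ}
    (h : j < n) : Mᴴ *ᵥ basisVec n j = star (M ⟨j, h⟩) := by
  rw [basisVec, dif_pos h, Matrix.mulVec_single_one]
  rfl

theorem extendZero_eq_apply {m : ℕ} (x : Fin (m + 3) → ℂ) :
    extendZero x 0 = x 0 ∧ extendZero x 1 = x 1 ∧ extendZero x 2 = x 2 :=
  ⟨extendZero_of_lt x (by omega), extendZero_of_lt x (by omega), tailSeq_zero x⟩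

theorem matT_conjTranspose_mulVec_zero (m : ℕ) (d b₁ b₂ ε : ℝ) :
    (matT (m + 3) d b₁ b₂ ε)ᴴ *ᵥ basisVec (m + 3) 0 = (2 / 3 : ℂ) • basisVec (m + 3) 0
      + (1 / (√3 : ℝ) : ℂ) • basisVec (m + 3) 1 + (d : ℂ) • basisVec (m + 3) 2 := by
  rw [conjTranspose_mulVec_basisVec _ (by omega), star_eq_iff_star_eq, eq_comm]
  -- A row of T is determined by its dot products with all x, so it can be read off from the
  -- coordinate formula.
  refine dotProduct_eq _ _ fun x => (matT_mulVec_zero m d b₁ b₂ ε x).trans ?_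
  simp [star_basisVec, basisVec_dotProduct, extendZero_eq_apply]

theorem matT_conjTranspose_mulVec_one (m : ℕ) (d b₁ b₂ ε : ℝ) :
    (matT (m + 3) d b₁ b₂ ε)ᴴ *ᵥ basisVec (m + 3) 1
      = (-(1 / (√3 : ℝ)) : ℂ) • basisVec (m + 3) 0
        + ((√3 : ℝ) * d : ℂ) • basisVec (m + 3) 2 := by
  rw [conjTranspose_mulVec_basisVec _ (by omega), star_eq_iff_star_eq, eq_comm]
  refine dotProduct_eq _ _ fun x => (matT_mulVec_one m d b₁ b₂ ε x).trans ?_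
  simp [star_basisVec, basisVec_dotProduct, extendZero_eq_apply]

theorem matT_conjTranspose_mulVec_two (m : ℕ) (d b₁ b₂ ε : ℝ) :
    (matT (m + 3) d b₁ b₂ ε)ᴴ *ᵥ basisVec (m + 3) 2
      = (d : ℂ) • basisVec (m + 3) 0 - ((√3 : ℝ) * d : ℂ) • basisVec (m + 3) 1
        + (3 / 2 * d ^ 2 + ε : ℂ) • basisVec (m + 3) 2 + (ε : ℂ) • basisVec (m + 3) 3 := by
  rw [conjTranspose_mulVec_basisVec _ (by omega), star_eq_iff_star_eq, eq_comm,
    ← fin_two_eq_mk]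
  refine dotProduct_eq _ _ fun x => (matT_mulVec_two m d b₁ b₂ ε x).trans ?_
  simp [star_basisVec, basisVec_dotProduct, extendZero_eq_apply, tailMap]
  ring

theorem matT_conjTranspose_mulVec_add_three (m : ℕ) (d b₁ b₂ ε : ℝ) {j : ℕ}
    (h : j + 3 < m + 3) :
    (matT (m + 3) d b₁ b₂ ε)ᴴ *ᵥ basisVec (m + 3) (j + 3)
      = ((ε : ℂ) ^ (j + 1)) • basisVec (m + 3) (j + 3)
        + ((ε : ℂ) ^ (j + 2)) • basisVec (m + 3) (j + 4) := by
  rw [conjTranspose_mulVec_basisVec _ h, star_eq_iff_star_eq, eq_comm]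
  refine dotProduct_eq _ _ fun x => (matT_mulVec_add_three m d b₁ b₂ ε x j h).trans ?_
  simp [star_basisVec, basisVec_dotProduct, tailMap]

theorem leadingVec_eq (m : ℕ) (a b : ℂ) :
    leadingVec m a b = a • basisVec (m + 3) 0 + b • basisVec (m + 3) 1 := by
  simp [leadingVec, basisVec]

theorem matT_conjTranspose_mulVec_leadingVec (m : ℕ) (d b₁ b₂ ε : ℝ) :
    (matT (m + 3) d b₁ b₂ ε)ᴴ *ᵥ leadingVec m (√3 : ℝ) (-1) = leadingVec m (√3 : ℝ) 1 := by
  have hs : ((√3 : ℝ) : ℂ) * (√3 : ℝ) = 3 := by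
    rw [← Complex.ofReal_mul, Real.mul_self_sqrt (by norm_num)]; norm_num
  have hs0 : ((√3 : ℝ) : ℂ) ≠ 0 := by
    rw [Complex.ofReal_ne_zero]; positivity
  rw [leadingVec_eq, leadingVec_eq, Matrix.mulVec_add, Matrix.mulVec_smul, Matrix.mulVec_smul,
    matT_conjTranspose_mulVec_zero, matT_conjTranspose_mulVec_one]
  have h1 : ((√3 : ℝ) : ℂ) * (1 / (√3 : ℝ)) = 1 := by field_simp
  have h2 : ((√3 : ℝ) : ℂ) * (2 / 3) + 1 / (√3 : ℝ) = (√3 : ℝ) := by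
    field_simp
    linear_combination -hs
  ext i
  simp only [Pi.add_apply, Pi.smul_apply, smul_eq_mul]
  linear_combination basisVec (m + 3) 1 i * h1 + basisVec (m + 3) 0 i * h2

theorem sum_normSq_eq_star_dotProduct {ι : Type*} [Fintype ι] (x : ι → ℂ) :
    ((∑ i, ‖x i‖ ^ 2 : ℝ) : ℂ) = star x ⬝ᵥ x := by
  push_cast
  exact Finset.sum_congr rfl fun i _ => (Complex.conj_mul' (x i)).symm

/-- The fixed space of `Tᴴ T` is spanned by the norm-attaining vector. -/
theorem eq_smul_leadingVec_of_fixed (m : ℕ) {d ε : ℝ} (b₁ b₂ : ℝ) (hd0 : 0 ≤ d)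
    (hd : 45 * d ^ 2 < 1) (h0 : 0 < ε) (h1 : ε ≤ 1 / 10) {y : Fin (m + 3) → ℂ}
    (hy : (matT (m + 3) d b₁ b₂ ε)ᴴ *ᵥ (matT (m + 3) d b₁ b₂ ε *ᵥ y) = y) :
    y = y 1 • leadingVec m (√3 : ℝ) 1 := by
  have hs : ((√3 : ℝ) : ℂ) * (√3 : ℝ) = 3 := by
    rw [← Complex.ofReal_mul, Real.mul_self_sqrt (by norm_num)]; norm_num
  have hN : ∑ i, ‖(matT (m + 3) d b₁ b₂ ε *ᵥ y) i‖ ^ 2 = ∑ i, ‖y i‖ ^ 2 := by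
    have : ((∑ i, ‖(matT (m + 3) d b₁ b₂ ε *ᵥ y) i‖ ^ 2 : ℝ) : ℂ)
        = ((∑ i, ‖y i‖ ^ 2 : ℝ) : ℂ) := by
      rw [sum_normSq_eq_star_dotProduct, sum_normSq_eq_star_dotProduct, Matrix.star_mulVec,
        ← Matrix.dotProduct_mulVec, hy]
    exact_mod_cast this
  have hle := sum_normSq_matT_mulVec_le m b₁ b₂ hd0 hd h0 h1 y
  have hnn : ∀ j ∈ Finset.range (m + 1), 0 ≤ ‖tailSeq y j‖ ^ 2 := fun j _ => by positivity
  have hsum := Finset.sum_nonneg hnn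
  have hdef : ‖defectCoord (y 0) (y 1)‖ ^ 2 = 0 :=
    le_antisymm (by linarith) (sq_nonneg _)
  have htail : ∑ j ∈ Finset.range (m + 1), ‖tailSeq y j‖ ^ 2 = 0 :=
    le_antisymm (by nlinarith [sq_nonneg ‖defectCoord (y 0) (y 1)‖]) hsum
  rw [Finset.sum_eq_zero_iff_of_nonneg hnn] at htail
  have hy0 : y 0 = (√3 : ℝ) * y 1 := by
    have : defectCoord (y 0) (y 1) = 0 := by simpa using hdef
    rw [defectCoord] at this
    linear_combination 2 * this
  rw [eq_leadingVec (x := y) fun j hj => by simpa using htail j (Finset.mem_range.2 hj),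
    leadingVec_one, hy0, leadingVec_eq, leadingVec_eq, smul_add, smul_smul, smul_smul, mul_one,
    mul_comm]

theorem mulVec_mem_eigenspace {ι : Type*} [Fintype ι] {X M : Matrix ι ι ℂ} (h : Commute X M)
    {μ : ℂ} {w : ι → ℂ} (hw : w ∈ Module.End.eigenspace X.mulVecLin μ) :
    M *ᵥ w ∈ Module.End.eigenspace X.mulVecLin μ := by
  rw [Module.End.mem_eigenspace_iff, Matrix.mulVecLin_apply] at hw ⊢
  rw [Matrix.mulVec_mulVec, h.eq, ← Matrix.mulVec_mulVec, hw, Matrix.mulVec_smul]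

/-- From f and g one gets e₁ and e₂; then Tᴴ moves forward along the basis, reaching e₃ because d ≠
0 and each later vector because ε ≠ 0. -/
theorem eq_smul_one_of_commute_matT (m : ℕ) {d ε : ℝ} (b₁ b₂ : ℝ) (hd0 : 0 < d)
    (hd : 45 * d ^ 2 < 1) (h0 : 0 < ε) (h1 : ε ≤ 1 / 10)
    {X : Matrix (Fin (m + 3)) (Fin (m + 3)) ℂ} (hX : Commute X (matT (m + 3) d b₁ b₂ ε))
    (hX' : Commute X (matT (m + 3) d b₁ b₂ ε)ᴴ) : ∃ μ : ℂ, X = μ • 1 := by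
  set T := matT (m + 3) d b₁ b₂ ε with hT
  have hTf : T *ᵥ leadingVec m (√3 : ℝ) 1 = _ := matT_mulVec_leadingVec m d b₁ b₂ ε
  have hTg : Tᴴ *ᵥ leadingVec m (√3 : ℝ) (-1) = _ :=
    matT_conjTranspose_mulVec_leadingVec m d b₁ b₂ ε
  have hfix : Tᴴ *ᵥ (T *ᵥ (X *ᵥ leadingVec m (√3 : ℝ) 1)) = X *ᵥ leadingVec m (√3 : ℝ) 1 := by
    rw [Matrix.mulVec_mulVec (M := T), ← hX.eq, ← Matrix.mulVec_mulVec, hTf,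
      Matrix.mulVec_mulVec, ← hX'.eq, ← Matrix.mulVec_mulVec, hTg]
  -- The second coordinate of f is 1, so the eigenvalue is read off there.
  set μ := (X *ᵥ leadingVec m (√3 : ℝ) 1) 1
  set V := Module.End.eigenspace X.mulVecLin μ with hV
  have hf : leadingVec m (√3 : ℝ) 1 ∈ V :=
    Module.End.mem_eigenspace_iff.2
      (eq_smul_leadingVec_of_fixed m b₁ b₂ hd0.le hd h0 h1 hfix)
  have hg : leadingVec m (√3 : ℝ) (-1) ∈ V := hTf ▸ mulVec_mem_eigenspace hX hf
  rw [leadingVec_eq] at hf hg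
  have hs0 : ((√3 : ℝ) : ℂ) ≠ 0 := by
    rw [Complex.ofReal_ne_zero]; positivity
  have hd0' : (d : ℂ) ≠ 0 := Complex.ofReal_ne_zero.2 hd0.ne'
  have he0' : (ε : ℂ) ≠ 0 := Complex.ofReal_ne_zero.2 h0.ne'
  have v0 : basisVec (m + 3) 0 ∈ V := by
    rw [← V.smul_mem_iff (mul_ne_zero two_ne_zero hs0)]
    convert V.add_mem hf hg using 1
    module
  have v1 : basisVec (m + 3) 1 ∈ V := by
    rw [← V.smul_mem_iff (two_ne_zero (α := ℂ))]
    convert V.sub_mem hf hg using 1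
    module
  have v2 : basisVec (m + 3) 2 ∈ V := by
    have h := mulVec_mem_eigenspace hX' v0
    rw [hT, matT_conjTranspose_mulVec_zero] at h
    rw [← V.smul_mem_iff hd0']
    exact (V.add_mem_iff_right (V.add_mem (V.smul_mem _ v0) (V.smul_mem _ v1))).1 h
  have v3 : basisVec (m + 3) 3 ∈ V := by
    have h := mulVec_mem_eigenspace hX' v2
    rw [hT, matT_conjTranspose_mulVec_two] at h
    rw [← V.smul_mem_iff he0']
    exact (V.add_mem_iff_right (V.add_mem
      (V.sub_mem (V.smul_mem _ v0) (V.smul_mem _ v1)) (V.smul_mem _ v2))).1 h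
  have vj : ∀ j, basisVec (m + 3) (j + 3) ∈ V := by
    intro j
    induction j with
    | zero => exact v3
    | succ j ih =>
      by_cases hj : j + 3 < m + 3
      · have h := mulVec_mem_eigenspace hX' ih
        rw [hT, matT_conjTranspose_mulVec_add_three _ _ _ _ _ hj] at h
        rw [← V.smul_mem_iff (pow_ne_zero (j + 2) he0')]
        exact (V.add_mem_iff_right (V.smul_mem _ ih)).1 h
      · rw [basisVec, dif_neg (by omega)]
        exact V.zero_mem
  have vall : ∀ j, basisVec (m + 3) j ∈ V
    | 0 => v0
    | 1 => v1
    | 2 => v2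
    | j + 3 => vj j
  refine ⟨μ, Matrix.ext_of_mulVec_single fun i => ?_⟩
  have h := Module.End.mem_eigenspace_iff.1 (vall i)
  rw [basisVec, dif_pos i.2, Matrix.mulVecLin_apply] at h
  rw [h, Matrix.smul_mulVec, Matrix.one_mulVec]

/-! ### Commutants and unitary similarity -/

theorem commute_conj_of_unitarilySimilar {ι κ : Type*} [Fintype ι] [DecidableEq ι] [Fintype κ]
    [DecidableEq κ] {S : Matrix ι ι ℂ} {R D : Matrix κ κ ℂ} {U : Matrix ι κ ℂ}
    (hU : U * Uᴴ = 1) (hS : Uᴴ * S * U = R) (hD : Commute D R) :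
    Commute (U * D * Uᴴ) S := by
  have h1 : S * U = U * R := by
    rw [← hS, ← Matrix.mul_assoc, ← Matrix.mul_assoc, hU, Matrix.one_mul]
  have h2 : Uᴴ * S = R * Uᴴ := by
    rw [← hS, Matrix.mul_assoc (Uᴴ * S), hU, Matrix.mul_one]
  calc U * D * Uᴴ * S = U * (D * R) * Uᴴ := by
        rw [Matrix.mul_assoc (U * D), h2]; simp only [Matrix.mul_assoc]
    _ = S * (U * D * Uᴴ) := by
        rw [hD.eq, ← Matrix.mul_assoc, ← h1]; simp only [Matrix.mul_assoc]

theorem unitarilyIrreducible_of_commutant {ι : Type*} [Fintype ι] [DecidableEq ι]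
    {S : Matrix ι ι ℂ}
    (h : ∀ X : Matrix ι ι ℂ, Commute X S → Commute X Sᴴ → ∃ μ : ℂ, X = μ • 1) :
    UnitarilyIrreducible S := by
  rintro ⟨p, q, A, C, hp, hq, U, hU1, hU2, hS⟩
  have hS' : Uᴴ * Sᴴ * U = matrixDirectSum Aᴴ Cᴴ := by
    have := congrArg Matrix.conjTranspose hS
    simpa [Matrix.conjTranspose_mul, Matrix.fromBlocks_conjTranspose, Matrix.mul_assoc] using this
  -- The projection onto the first summand; scalarity would force 1 = μ = 0, both summands being
  -- nonempty.
  set D : Matrix (Fin p ⊕ Fin q) (Fin p ⊕ Fin q) ℂ := matrixDirectSum 1 0 with hDdef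
  have hcomm : ∀ (A : Matrix (Fin p) (Fin p) ℂ) (C : Matrix (Fin q) (Fin q) ℂ),
      Commute D (matrixDirectSum A C) := fun A C => by
    simp [hDdef, Commute, SemiconjBy, Matrix.fromBlocks_multiply]
  obtain ⟨μ, hμ⟩ := h _ (commute_conj_of_unitarilySimilar hU2 hS (hcomm A C))
    (commute_conj_of_unitarilySimilar hU2 hS' (hcomm _ _))
  have hD : D = μ • 1 := by
    calc D = Uᴴ * U * D * (Uᴴ * U) := by rw [hU1, Matrix.one_mul, Matrix.mul_one]
      _ = Uᴴ * (U * D * Uᴴ) * U := by simp only [Matrix.mul_assoc]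
      _ = μ • 1 := by rw [hμ, Matrix.mul_smul, Matrix.mul_one, Matrix.smul_mul, hU1]
  have e1 := congrFun (congrFun hD (Sum.inl ⟨0, hp⟩)) (Sum.inl ⟨0, hp⟩)
  have e2 := congrFun (congrFun hD (Sum.inr ⟨0, hq⟩)) (Sum.inr ⟨0, hq⟩)
  simp [hDdef] at e1 e2
  exact one_ne_zero (e1.trans e2.symm)

/-- Compare the traces of U Uᴴ and Uᴴ U. -/
theorem UnitarilySimilar.card_eq {ι κ : Type*} [Fintype ι] [DecidableEq ι] [Fintype κ]
    [DecidableEq κ] {S : Matrix ι ι ℂ} {R : Matrix κ κ ℂ} (h : UnitarilySimilar S R) :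
    Fintype.card ι = Fintype.card κ := by
  obtain ⟨U, h1, h2, -⟩ := h
  have h3 := Matrix.trace_mul_comm U Uᴴ
  rw [h1, h2, Matrix.trace_one, Matrix.trace_one] at h3
  exact_mod_cast h3

theorem theorem3p7 (n : ℕ) (hn : 4 ≤ n) (d : ℝ) (hd : d ∈ Set.Ioo (0 : ℝ) (1 / √45))
    (b₁ b₂ : ℝ) :
    ∃ ε₀ : ℝ, 0 < ε₀ ∧ ∀ ε : ℝ, 0 < ε → ε < ε₀ →
      numericalRange (matT n d b₁ b₂ ε) ⊆ sector (Real.pi / 2) ∧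
      (matT n d b₁ b₂ ε + (matT n d b₁ b₂ ε)ᴴ).PosSemidef ∧
      matrixNorm (matT n d b₁ b₂ ε) / numericalRadius (matT n d b₁ b₂ ε) = √2 ∧
      UnitarilyIrreducible (matT n d b₁ b₂ ε) ∧
      ¬ ∃ (m : ℕ) (T₂ : Matrix (Fin m) (Fin m) ℂ),
        UnitarilySimilar
          (((matrixNorm (matT n d b₁ b₂ ε))⁻¹ : ℂ) • matT n d b₁ b₂ ε)
          (matrixDirectSum (extremalMatrix (Real.pi / 2)) T₂) := by
  obtain ⟨m, rfl⟩ : ∃ m, n = m + 3 := ⟨n - 3, by omega⟩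
  obtain ⟨hd0, hd1⟩ := hd
  have hd2 : 45 * d ^ 2 < 1 := by
    rw [lt_div_iff₀ (by positivity)] at hd1
    have h45 : √45 ^ 2 = 45 := Real.sq_sqrt (by norm_num)
    have h := pow_lt_pow_left₀ hd1 (by positivity) two_ne_zero
    rw [mul_pow, h45] at h
    linarith
  -- The bound 1/10 serves the norm estimate, the other one the numerical radius.
  refine ⟨min (1 / 10) ((1 - 45 * d ^ 2) / 4), lt_min (by norm_num) (by linarith), ?_⟩
  intro ε h0 hε
  have h1 : ε ≤ 1 / 10 := (hε.trans_le (min_le_left _ _)).le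
  have h2 : 4 * ε ≤ 1 - 45 * d ^ 2 := by linarith [hε.trans_le (min_le_right _ _)]
  have hre := re_star_dotProduct_matT_mulVec_nonneg m d b₁ b₂ h0 (by linarith)
  have hnorm := matrixNorm_matT m b₁ b₂ hd0.le hd2 h0 h1
  have hirr : UnitarilyIrreducible (matT (m + 3) d b₁ b₂ ε) :=
    unitarilyIrreducible_of_commutant fun X hX hX' =>
      eq_smul_one_of_commute_matT m b₁ b₂ hd0 hd2 h0 h1 hX hX'
  refine ⟨numericalRange_subset_sector hre, posSemidef_add_conjTranspose hre, ?_, hirr, ?_⟩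
  · rw [hnorm, numericalRadius_matT m b₁ b₂ h0 (by linarith) h2, one_div_one_div]
  · rintro ⟨k, T₂, hsim⟩
    -- The sizes give 2 + k = n > 2, so T₂ has positive size; since ‖T‖ = 1, the scaling is trivial.
    have hcard := hsim.card_eq
    simp only [Fintype.card_fin, Fintype.card_sum] at hcard
    rw [hnorm, Complex.ofReal_one, inv_one, one_smul] at hsim
    exact hirr ⟨2, k, _, T₂, two_pos, by omega, hsim⟩
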